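/- Let $G$ be a finite group and $N\trianglelefteq G$ a normal subgroup such that $G/N$ is cyclic, generated by the image of $q\in G$. The group of one-dimensional complex characters of $G/N$ acts on the set $\mathrm{Irr}\,G$ of irreducible complex characters of $G$ by tensoring. Let $U$ be a set of representatives of the orbits of this action (necessarily finite), and for $\rho\in U$ let $$m_\rho=\langle \mathrm{Res}_N\rho,\mathrm{Res}_N\rho\rangle=\frac1{\#N}\sum_{n\in N}\rho(n)\overline{\rho(n)},$$ which is a natural number. Let $\Theta$ be a (possibly zero) complex character of $G$. (i) $\Theta$ can be written as $\Theta=\sum_{\rho\in U}\Psi_\rho\otimes\rho$, where each $\Psi_\rho$ is a (possibly zero) finite-dimensional complex representation of $G$ with $N\subseteq\ker\Psi_\rho$. (Representations are identified with their characters where convenient; $\Psi_\rho(g)$ denotes the value of the character of $\Psi_\rho$.) (ii) For each $\rho$, the eigenvalues of $q$ acting on $\Psi_\rho$ (with multiplicity) are well-defined exactly up to multiplication by $m_\rho$-th roots of unity: if $(\Psi_\rho)_{\rho\in U}$ is a family as in (i) and $(\Psi'_\rho)_{\rho\in U}$ is any family of finite-dimensional representations of $G$ with $N\subseteq\ker\Psi'_\rho$,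 then $\Theta=\sum_{\rho\in U}\Psi'_\rho\otimes\rho$ if and only if for every $\rho\in U$ the eigenvalues of $q$ on $\Psi_\rho$ and on $\Psi'_\rho$ can be matched bijectively so that matched eigenvalues differ by multiplication by an $m_\rho$-th root of unity. Moreover, for every family $(\Psi_\rho)$ as in (i) and every $\rho\in U$ the following hold. (iii) For every integer $d\ge 0$, $$\Psi_\rho(q^{dm_\rho})=\frac{1}{\#N\cdot m_\rho}\sum_{g\in q^{dm_\rho}N}\overline{\rho(g)}\,\Theta(g).$$ (iv) The character $\Psi_\rho\otimes\rho$ is uniquely determined by (iii): if $\Phi$ is a finite-dimensional representation of $G$ that is trivial on $N$ and whose character takes the values given by the right-hand side of (iii) at $q^{dm_\rho}$ for all $d\ge0$, then $\Phi\otimes\rho=\Psi_\rho\otimes\rho$ as characters. Concretely, let $M$ be an integer with $\dim\Psi_\rho\le M$. There are a unique $0\le n\le M$ and unique (up to order) $\lambda_1,\dots,\lambda_n\in\mathbb C^\times$ such that $\sum_k\lambda_k^d=\Psi_\rho(q^{dm_\rho})$ for $d=1,\dots,M$. For some choice of the roots $\sqrt[m_\rho]{\lambda_k}$ these are the eigenvalues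 of $q$ on $\Psi_\rho$, so that $\Psi_\rho(q)=\sqrt[m_\rho]{\lambda_1}+\dots+\sqrt[m_\rho]{\lambda_n}$. The character $\Psi_\rho\otimes\rho$ is independent of this choice: for every choice of the $m_\rho$-th roots there is a representation $\Phi$ of $G$, trivial on $N$, on which $q$ has the chosen roots as eigenvalues, and every such $\Phi$ satisfies $\Phi\otimes\rho=\Psi_\rho\otimes\rho$ as characters. -/

import Mathlib

open scoped Pointwise ComplexConjugate

namespace CosetCharacter

variable {G : Type*} [Group G]

/-- `χ` is a complex character of `G`: the trace function of a finite-dimensional complex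
representation (the zero representation is allowed). -/
def IsCharacter (χ : G → ℂ) : Prop :=
  ∃ V : FDRep ℂ G, V.character = χ

/-- `Irr G`, the set of irreducible complex characters of `G`. -/
def Irr (G : Type*) [Group G] : Set (G → ℂ) :=
  {χ | ∃ V : FDRep ℂ G, Representation.IsIrreducible V.ρ ∧ V.character = χ}

/-- The orbit `[ρ]` under tensoring with the one-dimensional characters of `G ⧸ N`. -/
def twistOrbit (N : Subgroup G) [N.Normal] (ρ : G → ℂ) : Set (G → ℂ) :=
  {σ | ∃ ψ : G ⧸ N →* ℂˣ, ∀ g : G, σ g = (ψ (g : G ⧸ N) : ℂ) * ρ g}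

/-- `U` is a set of representatives of the orbits of the character group of `G ⧸ N` on `Irr G`. -/
def IsOrbitRepresentatives (N : Subgroup G) [N.Normal] (U : Set (G → ℂ)) : Prop :=
  U ⊆ Irr G ∧ ∀ σ ∈ Irr G, ∃! ρ, ρ ∈ U ∧ σ ∈ twistOrbit N ρ

/-- The inner product `⟨f₁, f₂⟩ = (1 / #H) ∑ f₁(h) conj(f₂(h))` of functions on a finite
group `H`. -/
noncomputable def charInner {H : Type*} [Group H] [Finite H] (f₁ f₂ : H → ℂ) : ℂ :=
  (Nat.card H : ℂ)⁻¹ * ∑ᶠ h : H, f₁ h * conj (f₂ h)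

/-- `Θ = ∑_{ρ ∈ U} Ψ_ρ ⊗ ρ` as characters of `G`, with all `Ψ_ρ` trivial on `N`.
Used for finite `U` only. -/
def IsDecomposition (N : Subgroup G) (U : Set (G → ℂ)) (Θ : G → ℂ) (Ψ : U → FDRep ℂ G) : Prop :=
  (∀ ρ : U, N ≤ MonoidHom.ker (Ψ ρ).ρ) ∧
    ∀ g : G, Θ g = ∑ᶠ ρ : U, (Ψ ρ).character g * ρ.1 g

/-- The multiset of eigenvalues, with algebraic multiplicities, of `g` acting on `V`. -/
noncomputable def eigenvalues (V : FDRep ℂ G) (g : G) : Multiset ℂ :=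
  (LinearMap.charpoly (V.ρ g)).roots

/-- The expression `(1 / (#N · m)) ∑_{g ∈ x N} conj(ρ(g)) Θ(g)`. -/
noncomputable def cosetAverage (N : Subgroup G) (m : ℕ) (ρ Θ : G → ℂ) (x : G) : ℂ :=
  1 / ((Nat.card N : ℂ) * (m : ℂ)) * ∑ᶠ g ∈ x • (N : Set G), conj (ρ g) * Θ g

/-- The multiset `s = {λ₁, …, λₙ}` consists of `n ≤ M` non-zero complex numbers
with `∑ₖ λₖ ^ d = a d` for `d = 1, …, M`. -/
def SolvesPowerSums (M : ℕ) (a : ℕ → ℂ) (s : Multiset ℂ) : Prop :=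
  s.card ≤ M ∧ (0 : ℂ) ∉ s ∧ ∀ d : ℕ, 1 ≤ d → d ≤ M → (s.map (fun z => z ^ d)).sum = a d

/-- `t` arises from `s` by choosing an `m`-th root of every member of `s`. -/
def IsChoiceOfRoots (m : ℕ) (s t : Multiset ℂ) : Prop :=
  t.map (fun z => z ^ m) = s

end CosetCharacter

/-! Let `m` be the order of the stabilizer `S` of `ρ` in the dual of `G ⧸ N`. Fourier inversion on
`G ⧸ N` turns the sum of `conj ρ * σ` over `xN` into inner products of `ψσ` with `ρ` on all of `G`;
by orthogonality it equals `#N` times the sum of `ψ(x)⁻¹` over the `ψ` with `ψσ = ρ`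
(`finsum_coset_conj_irr_mul_irr`). This vanishes for `σ` outside the orbit of `ρ`. For `σ = ρ` and
`x = q ^ (d * m)` it is `#N * m`, since `S` has order `m` and so is trivial at `x`; this gives
(iii), and `x = 1` identifies `m` with `m_ρ`.

Conversely, some `ψ` in `S` takes a primitive `m`-th root of unity as its value at `q`, so `ψρ = ρ`
forces `ρ` to vanish off the cosets of powers of `q ^ m` (`exists_mk_eq_mk_pow_of_ne_zero`). Hence
`Φ ⊗ ρ` depends only on the values `Φ(q ^ (d * m))`, the power sums of the `m`-th powers of the
eigenvalues of `q`. By Newton's identities these carry the same information as the multiset of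
`m`-th powers, that is, the eigenvalues up to `m`-th roots of unity. Existence in (i) is Maschke's
theorem, with each constituent written as a twist of its orbit representative. -/

namespace CosetCharacter

/-! ### Power sums -/

/-- Newton's identities, specialized from `MvPolynomial` to the entries of a list representing `s`.
-/
theorem esymm_recursion (s : Multiset ℂ) (k : ℕ) :
    (k : ℂ) * s.esymm k = (-1) ^ (k + 1) *
      ∑ a ∈ Finset.HasAntidiagonal.antidiagonal k with a.1 < k,
        (-1) ^ a.1 * s.esymm a.1 * (s.map (fun z => z ^ a.2)).sum := by
  obtain ⟨l, rfl⟩ := Quot.exists_rep s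
  have hf : (Finset.univ.val.map l.get : Multiset ℂ) = Quot.mk _ l := by
    rw [Fin.univ_val_map, List.ofFn_get]; rfl
  have hp : ∀ d : ℕ, MvPolynomial.aeval l.get (MvPolynomial.psum (Fin l.length) ℂ d) =
      ((Finset.univ.val.map l.get).map (fun z => z ^ d)).sum := by
    intro d
    rw [Multiset.map_map, MvPolynomial.psum, map_sum]
    simp only [map_pow, MvPolynomial.aeval_X]
    rfl
  have h := congrArg (MvPolynomial.aeval l.get) (MvPolynomial.mul_esymm_eq_sum (Fin l.length) ℂ k)
  simp only [map_mul, map_natCast, map_pow, map_neg, map_one, map_sum, hp,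
    MvPolynomial.aeval_esymm_eq_multiset_esymm, hf] at h
  exact h

/-- In characteristic zero Newton's identities can be solved for `esymm k` by induction, and the
`esymm k` are, up to sign, the coefficients of the monic polynomial with roots `s`. -/
theorem eq_of_powerSums_of_card {s t : Multiset ℂ} {M : ℕ} (hs : s.card = M) (ht : t.card = M)
    (h : ∀ d : ℕ, 1 ≤ d → d ≤ M →
      (s.map (fun z => z ^ d)).sum = (t.map (fun z => z ^ d)).sum) : s = t := by
  have he : ∀ k ≤ M, s.esymm k = t.esymm k := by
    intro k
    induction k using Nat.strong_induction_on with
    | _ k ih =>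
      intro hk
      rcases Nat.eq_zero_or_pos k with rfl | hpos
      · simp [Multiset.esymm]
      · have hk0 : (k : ℂ) ≠ 0 := by exact_mod_cast hpos.ne'
        refine mul_left_cancel₀ hk0 ?_
        rw [esymm_recursion, esymm_recursion]
        congr 1
        refine Finset.sum_congr rfl fun a ha => ?_
        simp only [Finset.mem_filter, Finset.HasAntidiagonal.mem_antidiagonal] at ha
        rw [ih a.1 ha.2 (by omega), h a.2 (by omega) (by omega)]
  rw [← Polynomial.roots_multiset_prod_X_sub_C s, ← Polynomial.roots_multiset_prod_X_sub_C t,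
    Multiset.prod_X_sub_X_eq_sum_esymm, Multiset.prod_X_sub_X_eq_sum_esymm, hs, ht]
  congr 1
  refine Finset.sum_congr rfl fun j hj => ?_
  rw [he j (by simpa [Nat.lt_succ_iff] using hj)]

theorem eq_of_powerSums {s t : Multiset ℂ} {M : ℕ} (hs : s.card ≤ M) (ht : t.card ≤ M)
    (hs0 : (0 : ℂ) ∉ s) (ht0 : (0 : ℂ) ∉ t)
    (h : ∀ d : ℕ, 1 ≤ d → d ≤ M →
      (s.map (fun z => z ^ d)).sum = (t.map (fun z => z ^ d)).sum) : s = t := by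
  -- Padding with zeros equalizes the cardinalities and leaves power sums of positive degree
  -- unchanged; the zeros can be filtered out again because neither multiset contains 0.
  have key : s + Multiset.replicate (M - s.card) 0 = t + Multiset.replicate (M - t.card) 0 := by
    refine eq_of_powerSums_of_card (M := M) (by simp; omega) (by simp; omega) fun d h1 hd => ?_
    have hd0 : d ≠ 0 := by omega
    simp [h d h1 hd, hd0]
  have hfilter : ∀ (u : Multiset ℂ) (k : ℕ), (0 : ℂ) ∉ u →
      (u + Multiset.replicate k 0).filter (· ≠ 0) = u := by
    intro u k hu
    rw [Multiset.filter_add, Multiset.filter_eq_self.2 fun a ha => ne_of_mem_of_not_mem ha hu,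
      Multiset.filter_eq_nil.2 fun a ha => by simpa using (Multiset.eq_of_mem_replicate ha),
      add_zero]
  rw [← hfilter s _ hs0, key, hfilter t _ ht0]

theorem existsUnique_solvesPowerSums {M : ℕ} {a : ℕ → ℂ} {s : Multiset ℂ}
    (hs : SolvesPowerSums M a s) : ∃! s, SolvesPowerSums M a s :=
  ⟨s, hs, fun _ ht => eq_of_powerSums ht.1 hs.1 ht.2.1 hs.2.1 fun d h1 hd =>
    (ht.2.2 d h1 hd).trans (hs.2.2 d h1 hd).symm⟩

/-- Two multisets agree up to `m`-th roots of unity iff their `m`-th powers agree. -/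
theorem rel_rootOfUnity_iff {m : ℕ} (hm : 0 < m) (s t : Multiset ℂ) :
    Multiset.Rel (fun a b : ℂ => ∃ ζ : ℂ, ζ ^ m = 1 ∧ b = ζ * a) s t ↔
      s.map (fun z => z ^ m) = t.map (fun z => z ^ m) := by
  rw [← Multiset.rel_eq, Multiset.rel_map]
  have h : ∀ a b : ℂ, (∃ ζ : ℂ, ζ ^ m = 1 ∧ b = ζ * a) ↔ a ^ m = b ^ m := by
    intro a b
    constructor
    · rintro ⟨ζ, hζ, rfl⟩
      rw [mul_pow, hζ, one_mul]
    · intro hab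
      rcases eq_or_ne a 0 with rfl | ha
      · refine ⟨1, one_pow _, ?_⟩
        rw [zero_pow hm.ne'] at hab
        simpa using eq_zero_of_pow_eq_zero hab.symm
      · exact ⟨b / a, by rw [div_pow, ← hab, div_self (pow_ne_zero _ ha)],
          (div_mul_cancel₀ b ha).symm⟩
  simp only [h]

/-! ### Endomorphisms of finite order -/

section FiniteOrder

variable {V : Type*} [AddCommGroup V] [Module ℂ V] [FiniteDimensional ℂ V]

/-- `X ^ n - 1` is separable, so `T` is semisimple and its generalized eigenspaces, which span over
`ℂ`, are eigenspaces. -/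
theorem exists_eigenbasis {T : Module.End ℂ V} {n : ℕ} (hn : 0 < n) (hT : T ^ n = 1) :
    ∃ (ι : Type) (_ : Fintype ι) (b : Module.Basis ι ℂ V) (e : ι → ℂ),
      ∀ i, T (b i) = e i • b i := by
  have hss : T.IsSemisimple := by
    refine Module.End.isSemisimple_of_squarefree_aeval_eq_zero (p := Polynomial.X ^ n - 1)
      (Polynomial.Separable.squarefree (Polynomial.X_pow_sub_one_separable_iff.2
        (by exact_mod_cast hn.ne'))) ?_
    simp [hT]
  have hspan : ⊤ ≤ Submodule.span ℂ {v : V | ∃ μ : ℂ, T v = μ • v} := by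
    rw [← Module.End.iSup_maxGenEigenspace_eq_top T]
    refine iSup_le fun μ => ?_
    rw [hss.isFinitelySemisimple.maxGenEigenspace_eq_eigenspace]
    intro v hv
    exact Submodule.subset_span ⟨μ, Module.End.mem_eigenspace_iff.1 hv⟩
  let b := Module.Basis.ofSpan hspan
  have hb : ∀ i, ∃ μ : ℂ, T (b i) = μ • b i := fun i =>
    Module.Basis.ofSpan_subset hspan ⟨i, rfl⟩
  choose e he using hb
  have : Finite _ := Module.Finite.finite_basis b
  let _ := Fintype.ofFinite
  -- Reindexing by `Fin` puts the index type in `Type`, whatever the universe of `V`.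
  refine ⟨Fin (Module.finrank ℂ V), inferInstance, b.reindex (Fintype.equivFinOfCardEq
    (Module.finrank_eq_card_basis b).symm), e ∘ (Fintype.equivFinOfCardEq
    (Module.finrank_eq_card_basis b).symm).symm, fun i => ?_⟩
  simp [he]

omit [FiniteDimensional ℂ V] in
theorem toMatrix_pow_of_eigenbasis {ι : Type*} [Fintype ι] [DecidableEq ι]
    {T : Module.End ℂ V} {b : Module.Basis ι ℂ V} {e : ι → ℂ} (h : ∀ i, T (b i) = e i • b i)
    (d : ℕ) : LinearMap.toMatrix b b (T ^ d) = Matrix.diagonal (e ^ d) := by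
  have h1 : LinearMap.toMatrix b b T = Matrix.diagonal e := by
    ext i j
    rw [LinearMap.toMatrix_apply, h, map_smul, Finsupp.smul_apply, Module.Basis.repr_self,
      Matrix.diagonal_apply, Finsupp.single_apply]
    rcases eq_or_ne i j with rfl | hij
    · simp
    · simp [hij, hij.symm]
  rw [← LinearMap.toMatrix_pow, h1, Matrix.diagonal_pow]

theorem roots_charpoly_of_eigenbasis {ι : Type*} [Fintype ι]
    {T : Module.End ℂ V} {b : Module.Basis ι ℂ V} {e : ι → ℂ} (h : ∀ i, T (b i) = e i • b i) :
    T.charpoly.roots = Finset.univ.val.map e := by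
  classical
  have h1 := toMatrix_pow_of_eigenbasis h 1
  rw [pow_one, pow_one] at h1
  rw [← LinearMap.charpoly_toMatrix T b, h1, Matrix.charpoly_diagonal]
  have := Polynomial.roots_multiset_prod_X_sub_C (Finset.univ.val.map e)
  rwa [Multiset.map_map] at this

theorem trace_pow_eq_sum_roots {T : Module.End ℂ V} {n : ℕ} (hn : 0 < n) (hT : T ^ n = 1) (d : ℕ) :
    LinearMap.trace ℂ V (T ^ d) = (T.charpoly.roots.map (fun z => z ^ d)).sum := by
  classical
  obtain ⟨ι, _, b, e, h⟩ := exists_eigenbasis hn hT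
  rw [roots_charpoly_of_eigenbasis h, LinearMap.trace_eq_matrix_trace ℂ b,
    toMatrix_pow_of_eigenbasis h, Matrix.trace_diagonal, Multiset.map_map]
  rfl

theorem pow_eq_one_of_mem_roots_charpoly {T : Module.End ℂ V} {n : ℕ} (hT : T ^ n = 1) {z : ℂ}
    (hz : z ∈ T.charpoly.roots) : z ^ n = 1 := by
  have hev : T.HasEigenvalue z :=
    (Module.End.hasEigenvalue_iff_isRoot_charpoly T z).2 (Polynomial.isRoot_of_mem_roots hz)
  obtain ⟨v, hv⟩ := hev.exists_hasEigenvector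
  have := hv.pow_apply n
  rw [hT, Module.End.one_apply] at this
  have h2 : (z ^ n - 1) • v = 0 := by rw [sub_smul, one_smul, ← this, sub_self]
  exact sub_eq_zero.1 ((smul_eq_zero.1 h2).resolve_right hv.2)

end FiniteOrder

/-! ### Characters of a finite group -/

section Characters

variable {G : Type*} [Group G]

section Finite

variable [Finite G]

theorem character_pow (V : FDRep ℂ G) (g : G) (d : ℕ) :
    V.character (g ^ d) = ((eigenvalues V g).map (fun z => z ^ d)).sum := by
  have h : V.ρ g ^ orderOf g = 1 := by rw [← map_pow, pow_orderOf_eq_one, map_one]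
  rw [FDRep.character, map_pow]
  exact trace_pow_eq_sum_roots (orderOf_pos g) h d

theorem character_eq_sum_eigenvalues (V : FDRep ℂ G) (g : G) :
    V.character g = (eigenvalues V g).sum := by
  simpa using character_pow V g 1

omit [Finite G] in
theorem pow_eq_one_of_mem_eigenvalues {V : FDRep ℂ G} {g : G} {n : ℕ} (h : V.ρ (g ^ n) = 1)
    {z : ℂ} (hz : z ∈ eigenvalues V g) : z ^ n = 1 := by
  rw [map_pow] at h
  exact pow_eq_one_of_mem_roots_charpoly h hz

omit [Finite G] in
theorem card_eigenvalues (V : FDRep ℂ G) (g : G) :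
    (eigenvalues V g).card = Module.finrank ℂ V := by
  rw [eigenvalues, ← LinearMap.charpoly_natDegree (V.ρ g)]
  exact (IsAlgClosed.splits _).natDegree_eq_card_roots.symm

/-- Eigenvalues of `g` are roots of unity, whose conjugates are their inverses; writing `g⁻¹` as a
natural power of `g` makes `character_pow` applicable. -/
theorem character_inv (V : FDRep ℂ G) (g : G) : V.character g⁻¹ = conj (V.character g) := by
  have hpos := orderOf_pos g
  have hg : g⁻¹ = g ^ (orderOf g - 1) := by
    rw [eq_comm, ← mul_eq_one_iff_eq_inv, ← pow_succ, Nat.sub_add_cancel hpos, pow_orderOf_eq_one]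
  rw [hg, character_pow, character_eq_sum_eigenvalues, map_multiset_sum]
  refine congrArg Multiset.sum (Multiset.map_congr rfl fun z hz => ?_)
  have hz1 : z ^ orderOf g = 1 :=
    pow_eq_one_of_mem_eigenvalues (by rw [pow_orderOf_eq_one, map_one]) hz
  have hnorm : ‖z‖ = 1 := Complex.norm_eq_one_of_pow_eq_one hz1 hpos.ne'
  have hz0 : z ≠ 0 := by
    rintro rfl
    simp at hnorm
  rw [← Complex.inv_eq_conj hnorm]
  exact eq_inv_of_mul_eq_one_left (by rw [← pow_succ, Nat.sub_add_cancel hpos, hz1])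

end Finite

/-- Schur orthogonality distinguishes isomorphism classes. Isomorphic representations have equal
characters, and for equal characters the same `V` can be used twice, so the converse is not needed.
-/
theorem sum_irr_mul_conj_irr [Fintype G] {χ σ : G → ℂ} (hχ : χ ∈ Irr G) (hσ : σ ∈ Irr G) :
    ∑ g, χ g * conj (σ g) = if χ = σ then (Nat.card G : ℂ) else 0 := by
  classical
  have hG : (Nat.card G : ℂ) ≠ 0 := by exact_mod_cast Nat.card_pos.ne'
  let _ : Invertible (Nat.card G : ℂ) := invertibleOfNonzero hG
  obtain ⟨V, hV, rfl⟩ := hχ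
  have key : ∀ W : FDRep ℂ G, Representation.IsIrreducible W.ρ →
      ∑ g, V.character g * conj (W.character g) =
        if Nonempty (Representation.Equiv W.ρ V.ρ) then (Nat.card G : ℂ) else 0 := by
    intro W hW
    have h := Representation.char_orthonormal (k := ℂ) (V := V) (W := W) V.ρ W.ρ
    rw [inv_mul_eq_iff_eq_mul₀ hG, mul_ite, mul_one, mul_zero] at h
    rw [← h]
    refine Finset.sum_congr rfl fun g _ => ?_
    rw [← character_inv]
    rfl
  by_cases h : V.character = σ
  · subst h
    rw [key V hV, if_pos rfl, if_pos ⟨Representation.Equiv.refl _⟩]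
  · obtain ⟨W, hW, rfl⟩ := hσ
    rw [key W hW, if_neg h, if_neg]
    rintro ⟨e⟩
    exact h (Representation.char_iso e).symm

/-- Orthogonality makes `Irr G` linearly independent in the finite-dimensional space `G → ℂ`. -/
theorem finite_irr [Finite G] : (Irr G).Finite := by
  cases nonempty_fintype G
  refine LinearIndependent.setFinite (R := ℂ) (M := G → ℂ) ?_
  rw [linearIndependent_iff']
  intro s c hc σ hσ
  have hG : (Nat.card G : ℂ) ≠ 0 := by exact_mod_cast Nat.card_pos.ne'
  have h : ∑ g, (∑ χ ∈ s, c χ • (χ : G → ℂ)) g * conj (σ.1 g) = 0 := by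
    rw [hc]
    simp
  simp only [Finset.sum_apply, Pi.smul_apply, smul_eq_mul, Finset.sum_mul] at h
  rw [Finset.sum_comm] at h
  simp only [mul_assoc, ← Finset.mul_sum] at h
  rw [Finset.sum_congr rfl fun χ _ => by rw [sum_irr_mul_conj_irr χ.2 σ.2]] at h
  rw [Finset.sum_eq_single σ] at h
  · simpa [hG] using h
  · intro χ _ hne
    rw [if_neg fun h' => hne (Subtype.ext h'), mul_zero]
  · exact fun h' => absurd hσ h'

/-- The twist of a representation by a one-dimensional character. -/
noncomputable def twist {V : Type*} [AddCommGroup V] [Module ℂ V] (ψ : G →* ℂˣ)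
    (π : Representation ℂ G V) : Representation ℂ G V where
  toFun g := (ψ g : ℂ) • π g
  map_one' := by simp
  map_mul' g h := by
    rw [map_mul, map_mul, Units.val_mul, smul_mul_smul_comm]

theorem isIrreducible_twist {V : Type*} [AddCommGroup V] [Module ℂ V] (ψ : G →* ℂˣ)
    {π : Representation ℂ G V} (h : π.IsIrreducible) : (twist ψ π).IsIrreducible := by
  let e : Subrepresentation (twist ψ π) ≃o Subrepresentation π :=
    { toFun := fun W => ⟨W.toSubmodule, fun g v hv => by
        have := W.toSubmodule.smul_mem ((ψ g : ℂ)⁻¹) (W.apply_mem_toSubmodule g hv)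
        rwa [show twist ψ π g v = (ψ g : ℂ) • π g v from rfl,
          inv_smul_smul₀ (Units.ne_zero _)] at this⟩
      invFun := fun W => ⟨W.toSubmodule, fun g v hv =>
        W.toSubmodule.smul_mem (ψ g : ℂ) (W.apply_mem_toSubmodule g hv)⟩
      left_inv := fun _ => rfl
      right_inv := fun _ => rfl
      map_rel_iff' := Iff.rfl }
  exact e.isSimpleOrder_iff.2 h

theorem twist_mem_irr (ψ : G →* ℂˣ) {χ : G → ℂ} (h : χ ∈ Irr G) :
    (fun g => (ψ g : ℂ) * χ g) ∈ Irr G := by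
  obtain ⟨V, hV, rfl⟩ := h
  refine ⟨FDRep.of (V := V) (twist ψ V.ρ), isIrreducible_twist ψ hV, ?_⟩
  ext g
  exact map_smul (LinearMap.trace ℂ V) (ψ g : ℂ) (V.ρ g)

theorem trace_eq_add_of_isCompl {V : Type*} [AddCommGroup V] [Module ℂ V] [FiniteDimensional ℂ V]
    {p q : Submodule ℂ V} (h : IsCompl p q) (f : Module.End ℂ V) (hp : ∀ v ∈ p, f v ∈ p)
    (hq : ∀ v ∈ q, f v ∈ q) : LinearMap.trace ℂ V f =
      LinearMap.trace ℂ p (f.restrict hp) + LinearMap.trace ℂ q (f.restrict hq) := by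
  rw [← LinearMap.trace_prodMap', ← LinearMap.trace_conj' _ (p.prodEquivOfIsCompl q h)]
  congr 1
  ext v
  obtain ⟨w, rfl⟩ := (p.prodEquivOfIsCompl q h).surjective v
  simp [LinearEquiv.conj_apply]

/-- Maschke's theorem and additivity of the trace, by induction on the dimension. The zero space is
not irreducible and gives the empty multiset. -/
theorem exists_irr_decomposition [Finite G] (n : ℕ) {V : Type} [AddCommGroup V] [Module ℂ V]
    [FiniteDimensional ℂ V] (π : Representation ℂ G V) (hn : Module.finrank ℂ V = n) :
    ∃ s : Multiset (G → ℂ), (∀ χ ∈ s, χ ∈ Irr G) ∧ s.sum = π.character := by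
  induction n using Nat.strong_induction_on generalizing V with
  | _ n ih =>
    by_cases hirr : π.IsIrreducible
    · exact ⟨{π.character}, by simpa using ⟨FDRep.of π, hirr, rfl⟩, by simp⟩
    by_cases hV : Subsingleton V
    · refine ⟨0, by simp, ?_⟩
      ext g
      rw [Representation.character, Subsingleton.elim (π g) 0, map_zero]
      rfl
    have hnt : Nontrivial (Subrepresentation π) := by
      refine ⟨⊥, ⊤, fun h => hV ?_⟩
      have h' : (⊥ : Submodule ℂ V) = ⊤ := congrArg Subrepresentation.toSubmodule h
      exact (Submodule.subsingleton_iff ℂ).1 (subsingleton_of_bot_eq_top h')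
    obtain ⟨W, hW⟩ : ∃ W : Subrepresentation π, ¬ (W = ⊥ ∨ W = ⊤) := by
      by_contra hcon
      push Not at hcon
      exact hirr ⟨hcon⟩
    push Not at hW
    have hG : NeZero (Nat.card G : ℂ) := ⟨by exact_mod_cast Nat.card_pos.ne'⟩
    have hss : Representation.IsSemisimpleRepresentation π := inferInstance
    obtain ⟨W', hWW'⟩ := exists_isCompl W
    have hc : IsCompl W.toSubmodule W'.toSubmodule := by
      rw [isCompl_iff, disjoint_iff, codisjoint_iff]
      exact ⟨congrArg Subrepresentation.toSubmodule hWW'.inf_eq_bot,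
        congrArg Subrepresentation.toSubmodule hWW'.sup_eq_top⟩
    have hdim := Submodule.finrank_add_eq_of_isCompl hc
    have hpos : ∀ X : Subrepresentation π, X ≠ ⊥ → 0 < Module.finrank ℂ X.toSubmodule := by
      intro X hX
      rw [Nat.pos_iff_ne_zero, Ne, Submodule.finrank_eq_zero]
      exact fun h => hX (Subrepresentation.toSubmodule_injective h)
    have h1 := hpos W hW.1
    have h2 := hpos W' fun h => hW.2 (by simpa [h] using hWW'.sup_eq_top)
    obtain ⟨s, hs, hs'⟩ := ih _ (by omega) W.toRepresentation rfl
    obtain ⟨t, ht, ht'⟩ := ih _ (by omega) W'.toRepresentation rfl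
    refine ⟨s + t, fun χ hχ => (Multiset.mem_add.1 hχ).elim (hs χ) (ht χ), ?_⟩
    rw [Multiset.sum_add, hs', ht']
    ext g
    exact (trace_eq_add_of_isCompl hc (π g) (W.apply_mem_toSubmodule g)
      (W'.apply_mem_toSubmodule g)).symm

end Characters

/-! ### The dual of a finite cyclic group -/

section Dual

variable {A : Type*} [Group A] [IsCyclic A] [Finite A]

theorem finite_dual : Finite (A →* ℂˣ) := by
  let _ : CommGroup A := IsCyclic.commGroup
  refine Nat.finite_of_card_ne_zero ?_
  rw [CommGroup.card_monoidHom_of_hasEnoughRootsOfUnity A ℂ]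
  exact Nat.card_pos.ne'

theorem card_dual : Nat.card (A →* ℂˣ) = Nat.card A := by
  let _ : CommGroup A := IsCyclic.commGroup
  exact CommGroup.card_monoidHom_of_hasEnoughRootsOfUnity A ℂ

open Classical in
theorem sum_dual_apply [Fintype (A →* ℂˣ)] (a : A) :
    ∑ ψ : A →* ℂˣ, (ψ a : ℂ) = if a = 1 then (Nat.card A : ℂ) else 0 := by
  let _ : CommGroup A := IsCyclic.commGroup
  split_ifs with ha
  · subst ha
    simp [← card_dual (A := A)]
  · obtain ⟨φ, hφ⟩ := CommGroup.exists_apply_ne_one_of_hasEnoughRootsOfUnity A ℂ ha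
    -- Multiplication by `φ` permutes the dual, so a factor `φ a ≠ 1` forces the sum to be 0.
    have h : (φ a : ℂ) * ∑ ψ : A →* ℂˣ, (ψ a : ℂ) = ∑ ψ : A →* ℂˣ, (ψ a : ℂ) := by
      rw [Finset.mul_sum]
      exact Fintype.sum_equiv (Equiv.mulLeft φ) _ _ fun ψ => by simp
    by_contra h0
    exact hφ (Units.ext (mul_right_cancel₀ h0 (h.trans (one_mul _).symm)))

omit [IsCyclic A] [Finite A] in
theorem dual_ext {a : A} (ha : Subgroup.zpowers a = ⊤) {φ ψ : A →* ℂˣ} (h : φ a = ψ a) : φ = ψ := by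
  ext b
  obtain ⟨k, rfl⟩ := Subgroup.mem_zpowers_iff.1 (ha ▸ Subgroup.mem_top b)
  simp [h]

/-- The characters in a subgroup `S` of the dual take all `#S`-th roots of unity as values at
a generator. -/
theorem exists_mem_dual_apply_eq {a : A} (ha : Subgroup.zpowers a = ⊤) (S : Subgroup (A →* ℂˣ))
    {z : ℂ} (hz : z ^ Nat.card S = 1) : ∃ ψ ∈ S, (ψ a : ℂ) = z := by
  have := finite_dual (A := A)
  have : NeZero (Nat.card S) := ⟨Nat.card_pos.ne'⟩
  let f : S → rootsOfUnity (Nat.card S) ℂ := fun ψ => ⟨ψ.1 a, by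
    have h := congrArg (fun φ : S => φ.1 a) (pow_card_eq_one' (x := ψ))
    exact (mem_rootsOfUnity _ _).2 h⟩
  have hf : Function.Injective f := fun φ ψ h =>
    Subtype.ext (dual_ext ha (congrArg Subtype.val h))
  -- A character is determined by its value at a generator, and both sides have `#S` elements.
  have hb : Function.Bijective f := by
    rw [Nat.bijective_iff_injective_and_card]
    exact ⟨hf, by rw [Complex.card_rootsOfUnity]⟩
  obtain ⟨ψ, hψ⟩ := hb.2 (rootsOfUnity.mkOfPowEq z hz)
  refine ⟨ψ.1, ψ.2, ?_⟩
  have := congrArg (fun u : rootsOfUnity (Nat.card S) ℂ => ((u : ℂˣ) : ℂ)) hψ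
  simpa [f] using this

theorem exists_multiset_dual {a : A} (ha : Subgroup.zpowers a = ⊤) {t : Multiset ℂ}
    (ht : ∀ z ∈ t, z ^ Nat.card A = 1) :
    ∃ s : Multiset (A →* ℂˣ), s.map (fun ψ => (ψ a : ℂ)) = t := by
  induction t using Multiset.induction_on with
  | empty => exact ⟨0, rfl⟩
  | cons z t ih =>
    obtain ⟨s, hs⟩ := ih fun w hw => ht w (Multiset.mem_cons_of_mem hw)
    obtain ⟨ψ, -, hψ⟩ := exists_mem_dual_apply_eq ha ⊤ (z := z) (by
      rw [Subgroup.card_top, card_dual]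
      exact ht z (Multiset.mem_cons_self z t))
    exact ⟨ψ ::ₘ s, by rw [Multiset.map_cons, hs, hψ]⟩

theorem card_subgroup_dual_dvd (S : Subgroup (A →* ℂˣ)) :
    Nat.card S ∣ Nat.card A := by
  rw [← card_dual (A := A)]
  exact S.card_subgroup_dvd_card

end Dual

/-! ### Representations trivial on `N` -/

section Cosets

variable {G : Type*} [Group G] {N : Subgroup G} [N.Normal]

/-- The sum of the one-dimensional representations in `s`. -/
noncomputable def diagonalRepresentation (s : Multiset (G ⧸ N →* ℂˣ)) :
    Representation ℂ G (Fin s.toList.length → ℂ) :=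
  (Algebra.lmul ℂ (Fin s.toList.length → ℂ) : _ →* Module.End ℂ _).comp
    (MonoidHom.pi fun i => (Units.coeHom ℂ).comp ((s.toList.get i).comp (QuotientGroup.mk' N)))

theorem diagonalRepresentation_apply (s : Multiset (G ⧸ N →* ℂˣ)) (g : G)
    (v : Fin s.toList.length → ℂ) (i : Fin s.toList.length) :
    diagonalRepresentation s g v i = ((s.toList.get i (g : G ⧸ N) : ℂˣ) : ℂ) * v i := rfl

/-- `diagonalRepresentation s` as an object of `FDRep ℂ G`. -/
noncomputable def diagonalRep (s : Multiset (G ⧸ N →* ℂˣ)) : FDRep ℂ G :=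
  FDRep.of (diagonalRepresentation s)

theorem le_ker_diagonalRep (s : Multiset (G ⧸ N →* ℂˣ)) :
    N ≤ MonoidHom.ker (diagonalRep s).ρ := by
  intro n hn
  have h : (n : G ⧸ N) = 1 := (QuotientGroup.eq_one_iff n).2 hn
  have h1 : diagonalRepresentation s n = 1 := by
    refine LinearMap.ext fun v => funext fun i => ?_
    rw [diagonalRepresentation_apply, h, map_one, Units.val_one, one_mul, Module.End.one_apply]
  exact h1

theorem eigenvalues_diagonalRep (s : Multiset (G ⧸ N →* ℂˣ)) (g : G) :
    eigenvalues (diagonalRep s) g = s.map (fun ψ => (ψ (g : G ⧸ N) : ℂ)) := by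
  have h := roots_charpoly_of_eigenbasis (T := diagonalRepresentation s g)
    (b := Pi.basisFun ℂ (Fin s.toList.length))
    (e := fun i => ((s.toList.get i (g : G ⧸ N) : ℂˣ) : ℂ)) (fun i => by
      refine funext fun j => ?_
      rw [diagonalRepresentation_apply, Pi.smul_apply, smul_eq_mul, Pi.basisFun_apply, Pi.single_apply]
      split_ifs with hij
      · rw [hij]
      · simp only [mul_zero])
  refine h.trans ?_
  conv_rhs => rw [← Multiset.coe_toList s]
  rw [Fin.univ_val_map, Multiset.map_coe]
  congr 1
  rw [← List.ofFn_get s.toList, List.map_ofFn]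
  simp

theorem character_diagonalRep [Finite G] (s : Multiset (G ⧸ N →* ℂˣ)) (g : G) :
    (diagonalRep s).character g = (s.map (fun ψ => (ψ (g : G ⧸ N) : ℂ))).sum := by
  rw [character_eq_sum_eigenvalues, eigenvalues_diagonalRep]

omit [N.Normal] in
theorem character_eq_of_mk_eq {Φ : FDRep ℂ G} (hΦ : N ≤ MonoidHom.ker Φ.ρ) {g h : G}
    (hgh : (g : G ⧸ N) = h) : Φ.character g = Φ.character h := by
  have hk : Φ.ρ (g⁻¹ * h) = 1 := hΦ (QuotientGroup.eq.1 hgh)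
  have : Φ.ρ h = Φ.ρ g := by rw [← mul_inv_cancel_left g h, map_mul, hk, mul_one]
  rw [FDRep.character, FDRep.character, this]

theorem pow_card_eq_one_of_mem_eigenvalues {Φ : FDRep ℂ G} (hΦ : N ≤ MonoidHom.ker Φ.ρ) {g : G}
    {z : ℂ} (hz : z ∈ eigenvalues Φ g) : z ^ Nat.card (G ⧸ N) = 1 := by
  refine pow_eq_one_of_mem_eigenvalues (hΦ ?_) hz
  rw [← QuotientGroup.eq_one_iff, QuotientGroup.mk_pow]
  exact pow_card_eq_one'

theorem eigenvalue_ne_zero [Finite G] {Φ : FDRep ℂ G} (hΦ : N ≤ MonoidHom.ker Φ.ρ) {g : G}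
    {z : ℂ} (hz : z ∈ eigenvalues Φ g) : z ≠ 0 := by
  rintro rfl
  have h := pow_card_eq_one_of_mem_eigenvalues hΦ hz
  rw [zero_pow Nat.card_pos.ne'] at h
  exact zero_ne_one h

theorem character_pow_mul [Finite G] (Φ : FDRep ℂ G) (q : G) (m d : ℕ) :
    Φ.character (q ^ (d * m)) =
      (((eigenvalues Φ q).map (fun z => z ^ m)).map (fun z => z ^ d)).sum := by
  rw [character_pow, Multiset.map_map]
  exact congrArg Multiset.sum (Multiset.map_congr rfl fun z _ => by
    rw [mul_comm, pow_mul, Function.comp])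

/-! ### Sums over cosets -/

/-- The characters of `G ⧸ N` which fix `ρ`. -/
def twistStabilizer (N : Subgroup G) [N.Normal] (ρ : G → ℂ) : Subgroup (G ⧸ N →* ℂˣ) where
  carrier := {ψ | ∀ g : G, (ψ (g : G ⧸ N) : ℂ) * ρ g = ρ g}
  one_mem' := by simp
  mul_mem' := fun {φ ψ} hφ hψ g => by
    rw [MonoidHom.mul_apply, Units.val_mul, mul_assoc, hψ, hφ]
  inv_mem' := fun {ψ} hψ g => by
    rw [MonoidHom.inv_apply, Units.val_inv_eq_inv_val, inv_mul_eq_iff_eq_mul₀ (Units.ne_zero _), hψ]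

theorem mem_twistStabilizer {ρ : G → ℂ} {ψ : G ⧸ N →* ℂˣ} :
    ψ ∈ twistStabilizer N ρ ↔ ∀ g : G, (ψ (g : G ⧸ N) : ℂ) * ρ g = ρ g := Iff.rfl

omit [N.Normal] in
theorem mem_smul_subgroup_iff {x g : G} : g ∈ x • (N : Set G) ↔ (x : G ⧸ N) = g := by
  rw [QuotientGroup.eq, mem_leftCoset_iff, SetLike.mem_coe]

/-- Fourier inversion: the indicator function of `xN` is the average of `ψ(x)⁻¹ ψ` over the dual of
`G ⧸ N`. -/
theorem finsum_coset_mul_card [Fintype G] [IsCyclic (G ⧸ N)] [Fintype (G ⧸ N →* ℂˣ)]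
    (f : G → ℂ) (x : G) : (∑ᶠ g ∈ x • (N : Set G), f g) * Nat.card (G ⧸ N) =
      ∑ ψ : G ⧸ N →* ℂˣ, (ψ (x : G ⧸ N) : ℂ)⁻¹ * ∑ g : G, (ψ (g : G ⧸ N) : ℂ) * f g := by
  classical
  have h : ∀ g : G, ∑ ψ : G ⧸ N →* ℂˣ, (ψ (x : G ⧸ N) : ℂ)⁻¹ * ((ψ (g : G ⧸ N) : ℂ) * f g) =
      if g ∈ x • (N : Set G) then f g * Nat.card (G ⧸ N) else 0 := by
    intro g
    have h1 := sum_dual_apply ((x : G ⧸ N)⁻¹ * g)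
    rw [inv_mul_eq_one] at h1
    simp only [map_mul, map_inv, Units.val_mul, Units.val_inv_eq_inv_val] at h1
    simp only [← mul_assoc]
    rw [← Finset.sum_mul, h1]
    simp only [mem_smul_subgroup_iff]
    split_ifs
    · exact mul_comm _ _
    · exact zero_mul _
  simp only [Finset.mul_sum]
  rw [Finset.sum_comm, Finset.sum_congr rfl fun g _ => h g, ← Finset.sum_filter, ← Finset.sum_mul,
    finsum_mem_eq_finite_toFinset_sum _ (Set.toFinite _)]
  congr 2
  ext g
  rw [Set.Finite.mem_toFinset, Finset.mem_filter_univ]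

open Classical in
theorem finsum_coset_conj_irr_mul_irr [Fintype G] [IsCyclic (G ⧸ N)] [Fintype (G ⧸ N →* ℂˣ)]
    {ρ σ : G → ℂ} (hρ : ρ ∈ Irr G) (hσ : σ ∈ Irr G) (x : G) :
    ∑ᶠ g ∈ x • (N : Set G), conj (ρ g) * σ g = Nat.card N *
      ∑ ψ : G ⧸ N →* ℂˣ, if (fun g : G => (ψ (g : G ⧸ N) : ℂ) * σ g) = ρ then
        (ψ (x : G ⧸ N) : ℂ)⁻¹ else 0 := by
  have hc : (Nat.card (G ⧸ N) : ℂ) ≠ 0 := by exact_mod_cast Nat.card_pos.ne'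
  refine mul_right_cancel₀ hc ?_
  rw [finsum_coset_mul_card, Finset.mul_sum, Finset.sum_mul]
  refine Finset.sum_congr rfl fun ψ _ => ?_
  have h := sum_irr_mul_conj_irr (twist_mem_irr (ψ.comp (QuotientGroup.mk' N)) hσ) hρ
  have h' : ∑ g : G, (ψ (g : G ⧸ N) : ℂ) * (conj (ρ g) * σ g) =
      if (fun g : G => (ψ (g : G ⧸ N) : ℂ) * σ g) = ρ then (Nat.card G : ℂ) else 0 := by
    refine Eq.trans (Finset.sum_congr rfl fun g _ => ?_) h
    simp only [MonoidHom.comp_apply, QuotientGroup.mk'_apply]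
    ring
  rw [h', Subgroup.card_eq_card_quotient_mul_card_subgroup N]
  split_ifs
  · push_cast
    ring
  · simp

theorem finsum_coset_eq_zero [Finite G] [IsCyclic (G ⧸ N)] {ρ σ : G → ℂ} (hρ : ρ ∈ Irr G)
    (hσ : σ ∈ Irr G) (h : ρ ∉ twistOrbit N σ) (x : G) :
    ∑ᶠ g ∈ x • (N : Set G), conj (ρ g) * σ g = 0 := by
  classical
  cases nonempty_fintype G
  have := finite_dual (A := G ⧸ N)
  cases nonempty_fintype (G ⧸ N →* ℂˣ)
  rw [finsum_coset_conj_irr_mul_irr hρ hσ, Finset.sum_eq_zero, mul_zero]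
  intro ψ _
  rw [if_neg]
  rintro rfl
  exact h ⟨ψ, fun _ => rfl⟩

/-- The `ψ` with `ψρ = ρ` form the stabilizer, and `hx` makes each of them contribute 1. -/
theorem finsum_coset_self [Finite G] [IsCyclic (G ⧸ N)] {ρ : G → ℂ} (hρ : ρ ∈ Irr G) {x : G}
    (hx : ∀ ψ ∈ twistStabilizer N ρ, ψ (x : G ⧸ N) = 1) :
    ∑ᶠ g ∈ x • (N : Set G), conj (ρ g) * ρ g = Nat.card N * Nat.card (twistStabilizer N ρ) := by
  classical
  cases nonempty_fintype G
  have := finite_dual (A := G ⧸ N)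
  cases nonempty_fintype (G ⧸ N →* ℂˣ)
  rw [finsum_coset_conj_irr_mul_irr hρ hρ]
  congr 1
  have h : ∀ ψ : G ⧸ N →* ℂˣ, (if (fun g : G => (ψ (g : G ⧸ N) : ℂ) * ρ g) = ρ then
      (ψ (x : G ⧸ N) : ℂ)⁻¹ else 0) = if ψ ∈ twistStabilizer N ρ then 1 else 0 := by
    intro ψ
    rw [mem_twistStabilizer, ← funext_iff (f := fun g : G => (ψ (g : G ⧸ N) : ℂ) * ρ g)]
    split_ifs with h1
    · rw [hx ψ (mem_twistStabilizer.2 (congrFun h1)), Units.val_one, inv_one]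
    · rfl
  simp only [h]
  rw [Finset.sum_boole, Nat.card_eq_fintype_card, Fintype.card_subtype]

theorem card_twistStabilizer_eq_charInner [Finite G] [IsCyclic (G ⧸ N)] {ρ : G → ℂ}
    (hρ : ρ ∈ Irr G) : (Nat.card (twistStabilizer N ρ) : ℂ) =
      charInner (fun n : N => ρ (n : G)) (fun n : N => ρ (n : G)) := by
  have hN : (Nat.card N : ℂ) ≠ 0 := by exact_mod_cast Nat.card_pos.ne'
  have h := finsum_coset_self (N := N) hρ (x := 1) fun ψ _ => by simp
  rw [one_smul] at h
  have h' : ∑ᶠ n : N, ρ (n : G) * conj (ρ (n : G)) =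
      ∑ᶠ g ∈ (N : Set G), conj (ρ g) * ρ g := by
    rw [← finsum_set_coe_eq_finsum_mem]
    exact finsum_congr fun n => mul_comm _ _
  rw [charInner, h', h, inv_mul_cancel_left₀ hN]

end Cosets

/-! ### Vanishing outside the powers of `q ^ m` -/

section Decomposition

variable {G : Type*} [Group G] [Finite G] {N : Subgroup G} [N.Normal] {q : G}

omit [Finite G] in
theorem isCyclic_quotient (hq : Subgroup.zpowers (q : G ⧸ N) = ⊤) : IsCyclic (G ⧸ N) :=
  ⟨q, (Subgroup.eq_top_iff' _).1 hq⟩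

theorem card_twistStabilizer_pos [IsCyclic (G ⧸ N)] (ρ : G → ℂ) :
    0 < Nat.card (twistStabilizer N ρ) := by
  have := finite_dual (A := G ⧸ N)
  exact Nat.card_pos

theorem exists_mk_eq_mk_pow_of_ne_zero (hq : Subgroup.zpowers (q : G ⧸ N) = ⊤) {ρ : G → ℂ} {g : G}
    (hg : ρ g ≠ 0) :
    ∃ d : ℕ, (g : G ⧸ N) = (q ^ (d * Nat.card (twistStabilizer N ρ)) : G) := by
  have := isCyclic_quotient hq
  have hm := card_twistStabilizer_pos (N := N) ρ
  obtain ⟨k, hk⟩ := (mem_powers_iff_mem_zpowers).2 (hq ▸ Subgroup.mem_top (g : G ⧸ N))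
  have hζ := Complex.isPrimitiveRoot_exp _ hm.ne'
  obtain ⟨ψ, hψ, hψq⟩ := exists_mem_dual_apply_eq hq (twistStabilizer N ρ) hζ.pow_eq_one
  -- `ψρ = ρ` with `ρ g ≠ 0` forces `ψ g = 1`; as `ψ q` is a primitive root of unity, its order
  -- divides the exponent `k` of `q`.
  have h1 : (ψ (g : G ⧸ N) : ℂ) = 1 := mul_right_cancel₀ hg ((hψ g).trans (one_mul _).symm)
  rw [← hk] at h1
  simp only [map_pow, Units.val_pow_eq_pow_val, hψq] at h1
  obtain ⟨d, rfl⟩ := hζ.dvd_of_pow_eq_one k h1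
  exact ⟨d, by rw [← hk, mul_comm]; rfl⟩

/-- Where `ρ` does not vanish, `g` lies in the coset of some `q ^ (d * m)`, on which both characters
are constant. -/
theorem character_mul_eq_of_pow (hq : Subgroup.zpowers (q : G ⧸ N) = ⊤) {ρ : G → ℂ}
    {Φ Φ' : FDRep ℂ G} (hΦ : N ≤ MonoidHom.ker Φ.ρ) (hΦ' : N ≤ MonoidHom.ker Φ'.ρ)
    (h : ∀ d : ℕ, Φ.character (q ^ (d * Nat.card (twistStabilizer N ρ))) =
      Φ'.character (q ^ (d * Nat.card (twistStabilizer N ρ)))) :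
    Φ.character * ρ = Φ'.character * ρ := by
  ext g
  by_cases hg : ρ g = 0
  · simp [hg]
  · obtain ⟨d, hd⟩ := exists_mk_eq_mk_pow_of_ne_zero hq hg
    rw [Pi.mul_apply, Pi.mul_apply, character_eq_of_mk_eq hΦ hd, character_eq_of_mk_eq hΦ' hd, h]

theorem map_pow_eigenvalues_eq {Φ Φ' : FDRep ℂ G} (hΦ : N ≤ MonoidHom.ker Φ.ρ)
    (hΦ' : N ≤ MonoidHom.ker Φ'.ρ) {m : ℕ}
    (h : ∀ d : ℕ, Φ.character (q ^ (d * m)) = Φ'.character (q ^ (d * m))) :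
    (eigenvalues Φ q).map (fun z => z ^ m) = (eigenvalues Φ' q).map (fun z => z ^ m) := by
  have h0 : ∀ {Φ : FDRep ℂ G}, N ≤ MonoidHom.ker Φ.ρ →
      (0 : ℂ) ∉ (eigenvalues Φ q).map (fun z => z ^ m) := by
    intro Φ hΦ h0
    obtain ⟨z, hz, hz0⟩ := Multiset.mem_map.1 h0
    exact pow_ne_zero m (eigenvalue_ne_zero hΦ hz) hz0
  refine eq_of_powerSums (le_max_left _ _) (le_max_right _ _) (h0 hΦ) (h0 hΦ') fun d _ _ => ?_
  rw [← character_pow_mul, ← character_pow_mul, h]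

theorem character_pow_mul_congr {Φ Φ' : FDRep ℂ G} {m : ℕ}
    (h : (eigenvalues Φ q).map (fun z => z ^ m) = (eigenvalues Φ' q).map (fun z => z ^ m)) (d : ℕ) :
    Φ.character (q ^ (d * m)) = Φ'.character (q ^ (d * m)) := by
  rw [character_pow_mul, character_pow_mul, h]

theorem card_twistStabilizer_dvd [IsCyclic (G ⧸ N)] (ρ : G → ℂ) :
    Nat.card (twistStabilizer N ρ) ∣ Nat.card (G ⧸ N) :=
  card_subgroup_dual_dvd _

theorem solvesPowerSums_eigenvalues {Φ : FDRep ℂ G} (hΦ : N ≤ MonoidHom.ker Φ.ρ) (m : ℕ) {M : ℕ}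
    (hM : Module.finrank ℂ Φ ≤ M) :
    SolvesPowerSums M (fun d => Φ.character (q ^ (d * m)))
      ((eigenvalues Φ q).map (fun z => z ^ m)) := by
  refine ⟨by rwa [Multiset.card_map, card_eigenvalues], fun h0 => ?_,
    fun d _ _ => (character_pow_mul Φ q m d).symm⟩
  obtain ⟨z, hz, hz0⟩ := Multiset.mem_map.1 h0
  exact pow_ne_zero m (eigenvalue_ne_zero hΦ hz) hz0

/-! ### Decompositions -/

variable {U : Set (G → ℂ)} {Θ : G → ℂ}

theorem IsOrbitRepresentatives.finite (hU : IsOrbitRepresentatives N U) : U.Finite :=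
  finite_irr.subset hU.1

omit [Finite G] in
theorem IsOrbitRepresentatives.notMem_twistOrbit (hU : IsOrbitRepresentatives N U) {ρ σ : G → ℂ}
    (hρ : ρ ∈ U) (hσ : σ ∈ U) (h : σ ≠ ρ) : ρ ∉ twistOrbit N σ := fun hmem =>
  h ((hU.2 ρ (hU.1 hρ)).unique ⟨hσ, hmem⟩ ⟨hρ, 1, fun g => by simp⟩)

theorem exists_isDecomposition (hU : IsOrbitRepresentatives N U) (hΘ : IsCharacter Θ) :
    ∃ Ψ : U → FDRep ℂ G, IsDecomposition N U Θ Ψ := by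
  classical
  have := hU.finite.to_subtype
  cases nonempty_fintype U
  obtain ⟨V, rfl⟩ := hΘ
  obtain ⟨s, hs, hsum⟩ := exists_irr_decomposition _ (V := V) V.ρ rfl
  -- Each constituent `χ = ψρ` adds `ψ` to the multiset `e ρ`, from which `diagonalRep` then builds
  -- `Ψ ρ`.
  have key : ∃ e : U → Multiset (G ⧸ N →* ℂˣ), ∀ g : G,
      s.sum g = ∑ ρ : U, ((e ρ).map (fun ψ => (ψ (g : G ⧸ N) : ℂ))).sum * ρ.1 g := by
    clear hsum
    induction s using Multiset.induction_on with
    | empty => exact ⟨0, by simp⟩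
    | cons χ s ih =>
      obtain ⟨e, he⟩ := ih fun σ hσ => hs σ (Multiset.mem_cons_of_mem hσ)
      obtain ⟨ρ, ⟨hρ, ψ, hψ⟩, -⟩ := hU.2 χ (hs χ (Multiset.mem_cons_self χ s))
      refine ⟨e + Pi.single ⟨ρ, hρ⟩ {ψ}, fun g => ?_⟩
      simp only [Pi.add_apply, Multiset.map_add, Multiset.sum_add, add_mul, Finset.sum_add_distrib,
        Multiset.sum_cons, ← he g]
      rw [add_comm, Finset.sum_eq_single ⟨ρ, hρ⟩, hψ]
      · simp
      · intro σ _ hσ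
        simp [hσ]
      · simp
  obtain ⟨e, he⟩ := key
  refine ⟨fun ρ => diagonalRep (e ρ), fun ρ => le_ker_diagonalRep _, fun g => ?_⟩
  rw [finsum_eq_sum_of_fintype]
  simp only [character_diagonalRep]
  rw [← he, hsum]
  rfl

theorem IsDecomposition.character_pow (hq : Subgroup.zpowers (q : G ⧸ N) = ⊤)
    (hU : IsOrbitRepresentatives N U) {Ψ : U → FDRep ℂ G} (hΨ : IsDecomposition N U Θ Ψ) (ρ : U)
    (d : ℕ) : (Ψ ρ).character (q ^ (d * Nat.card (twistStabilizer N ρ.1))) =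
      cosetAverage N (Nat.card (twistStabilizer N ρ.1)) ρ.1 Θ
        (q ^ (d * Nat.card (twistStabilizer N ρ.1))) := by
  classical
  have := isCyclic_quotient hq
  have := hU.finite.to_subtype
  have := finite_dual (A := G ⧸ N)
  cases nonempty_fintype U
  cases nonempty_fintype G
  have hm : (Nat.card (twistStabilizer N ρ.1) : ℂ) ≠ 0 := by
    exact_mod_cast (card_twistStabilizer_pos (N := N) ρ.1).ne'
  have hN : (Nat.card N : ℂ) ≠ 0 := by exact_mod_cast Nat.card_pos.ne'
  have hx : ∀ ψ ∈ twistStabilizer N ρ.1,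
      ψ ((q ^ (d * Nat.card (twistStabilizer N ρ.1)) : G) : G ⧸ N) = 1 := by
    intro ψ hψ
    have h := congrArg (fun φ : twistStabilizer N ρ.1 => φ.1 (q : G ⧸ N))
      (pow_card_eq_one' (x := (⟨ψ, hψ⟩ : twistStabilizer N ρ.1)))
    replace h : ψ (q : G ⧸ N) ^ Nat.card (twistStabilizer N ρ.1) = 1 := h
    rw [QuotientGroup.mk_pow, map_pow, mul_comm, pow_mul, h, one_pow]
  generalize q ^ (d * Nat.card (twistStabilizer N ρ.1)) = x at hx ⊢
  -- Each `Ψ σ` has constant character on `xN` and factors out of the coset sum; only the term `σ =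
  -- ρ` survives.
  have h1 : ∑ᶠ g ∈ x • (N : Set G), conj (ρ.1 g) * Θ g =
      ∑ σ : U, (Ψ σ).character x * ∑ᶠ g ∈ x • (N : Set G), conj (ρ.1 g) * σ.1 g := by
    simp only [finsum_mem_eq_finite_toFinset_sum _ (Set.toFinite (x • (N : Set G))),
      Finset.mul_sum]
    rw [Finset.sum_comm]
    refine Finset.sum_congr rfl fun g hg => ?_
    rw [Set.Finite.mem_toFinset, mem_smul_subgroup_iff] at hg
    rw [hΨ.2, finsum_eq_sum_of_fintype, Finset.mul_sum]
    refine Finset.sum_congr rfl fun σ _ => ?_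
    rw [character_eq_of_mk_eq (hΨ.1 σ) hg]
    ring
  rw [cosetAverage, h1, Finset.sum_eq_single ρ, finsum_coset_self (hU.1 ρ.2) hx]
  · field_simp
  · intro σ _ hσ
    rw [finsum_coset_eq_zero (hU.1 ρ.2) (hU.1 σ.2)
      (hU.notMem_twistOrbit ρ.2 σ.2 fun h => hσ (Subtype.ext h)), mul_zero]
  · simp

theorem IsDecomposition.iff_rel (hq : Subgroup.zpowers (q : G ⧸ N) = ⊤)
    (hU : IsOrbitRepresentatives N U) {Ψ Ψ' : U → FDRep ℂ G} (hΨ : IsDecomposition N U Θ Ψ)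
    (hΨ' : ∀ ρ : U, N ≤ MonoidHom.ker (Ψ' ρ).ρ) :
    IsDecomposition N U Θ Ψ' ↔ ∀ ρ : U, Multiset.Rel
      (fun a b : ℂ => ∃ ζ : ℂ, ζ ^ Nat.card (twistStabilizer N ρ.1) = 1 ∧ b = ζ * a)
      (eigenvalues (Ψ ρ) q) (eigenvalues (Ψ' ρ) q) := by
  have := isCyclic_quotient hq
  simp only [rel_rootOfUnity_iff (card_twistStabilizer_pos _)]
  constructor
  · intro h ρ
    exact map_pow_eigenvalues_eq (hΨ.1 ρ) (hΨ' ρ) fun d =>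
      (hΨ.character_pow hq hU ρ d).trans (h.character_pow hq hU ρ d).symm
  · refine fun h => ⟨hΨ', fun g => (hΨ.2 g).trans (finsum_congr fun ρ => ?_)⟩
    exact congrFun (character_mul_eq_of_pow hq (hΨ.1 ρ) (hΨ' ρ)
      (character_pow_mul_congr (h ρ))) g

/-- Since `m` divides `#(G ⧸ N)`, a root `z` with `z ^ m = w ^ m` satisfies `z ^ #(G ⧸ N) = w ^ #(G
⧸ N) = 1`, so it is the value at `q` of a character of `G ⧸ N`. -/
theorem exists_eigenvalues_eq_of_isChoiceOfRoots (hq : Subgroup.zpowers (q : G ⧸ N) = ⊤)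
    {ρ : G → ℂ} {Φ : FDRep ℂ G} (hΦ : N ≤ MonoidHom.ker Φ.ρ) {t : Multiset ℂ}
    (ht : IsChoiceOfRoots (Nat.card (twistStabilizer N ρ))
      ((eigenvalues Φ q).map (fun z => z ^ Nat.card (twistStabilizer N ρ))) t) :
    ∃ Φ' : FDRep ℂ G, N ≤ MonoidHom.ker Φ'.ρ ∧ eigenvalues Φ' q = t := by
  have := isCyclic_quotient hq
  obtain ⟨k, hk⟩ := card_twistStabilizer_dvd (N := N) ρ
  obtain ⟨s, hs⟩ := exists_multiset_dual hq (t := t) fun z hz => by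
    have hz' := Multiset.mem_map_of_mem (fun z : ℂ => z ^ Nat.card (twistStabilizer N ρ)) hz
    rw [show t.map (fun z => z ^ Nat.card (twistStabilizer N ρ)) = _ from ht] at hz'
    obtain ⟨w, hw, hwz⟩ := Multiset.mem_map.1 hz'
    have := pow_card_eq_one_of_mem_eigenvalues hΦ hw
    rw [hk, pow_mul] at this ⊢
    rw [← this, hwz]
  exact ⟨diagonalRep s, le_ker_diagonalRep s, by rw [eigenvalues_diagonalRep, hs]⟩

end Decomposition

end CosetCharacter

theorem corollary5 {G : Type*} [Group G] [Finite G] (N : Subgroup G) [N.Normal] (q : G)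
    (hq : Subgroup.zpowers (q : G ⧸ N) = ⊤)
    (U : Set (G → ℂ)) (hU : CosetCharacter.IsOrbitRepresentatives N U)
    (Θ : G → ℂ) (hΘ : CosetCharacter.IsCharacter Θ) :
    U.Finite ∧
    ∃ m : U → ℕ,
      (∀ ρ : U, (m ρ : ℂ) =
        CosetCharacter.charInner (fun n : N => ρ.1 (n : G)) (fun n : N => ρ.1 (n : G))) ∧
      -- (i) existence of a decomposition
      (∃ Ψ : U → FDRep ℂ G, CosetCharacter.IsDecomposition N U Θ Ψ) ∧
      -- (ii) the indeterminacy of the eigenvalues is exactly by `m ρ`-th roots of unity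
      (∀ Ψ Ψ' : U → FDRep ℂ G, CosetCharacter.IsDecomposition N U Θ Ψ →
        (∀ ρ : U, N ≤ MonoidHom.ker (Ψ' ρ).ρ) →
        (CosetCharacter.IsDecomposition N U Θ Ψ' ↔
          ∀ ρ : U, Multiset.Rel (fun a b : ℂ => ∃ ζ : ℂ, ζ ^ m ρ = 1 ∧ b = ζ * a)
            (CosetCharacter.eigenvalues (Ψ ρ) q) (CosetCharacter.eigenvalues (Ψ' ρ) q))) ∧
      ∀ Ψ : U → FDRep ℂ G, CosetCharacter.IsDecomposition N U Θ Ψ → ∀ ρ : U,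
        -- (iii) the formula for the values at powers of `q ^ m ρ`
        (∀ d : ℕ, (Ψ ρ).character (q ^ (d * m ρ)) =
          CosetCharacter.cosetAverage N (m ρ) ρ.1 Θ (q ^ (d * m ρ))) ∧
        -- (iv) these values determine `Ψ ρ ⊗ ρ`
        (∀ Φ : FDRep ℂ G, N ≤ MonoidHom.ker Φ.ρ →
          (∀ d : ℕ, Φ.character (q ^ (d * m ρ)) =
            CosetCharacter.cosetAverage N (m ρ) ρ.1 Θ (q ^ (d * m ρ))) →
          Φ.character * ρ.1 = (Ψ ρ).character * ρ.1) ∧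
        -- (iv) concretely, through power sums and `m ρ`-th roots
        (∀ M : ℕ, Module.finrank ℂ (Ψ ρ) ≤ M →
          (∃! s : Multiset ℂ, CosetCharacter.SolvesPowerSums M
            (fun d => (Ψ ρ).character (q ^ (d * m ρ))) s) ∧
          ∀ s : Multiset ℂ, CosetCharacter.SolvesPowerSums M
              (fun d => (Ψ ρ).character (q ^ (d * m ρ))) s →
            (∃ t : Multiset ℂ, CosetCharacter.IsChoiceOfRoots (m ρ) s t ∧
              CosetCharacter.eigenvalues (Ψ ρ) q = t ∧ (Ψ ρ).character q = t.sum) ∧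
            (∀ t : Multiset ℂ, CosetCharacter.IsChoiceOfRoots (m ρ) s t →
              (∃ Φ : FDRep ℂ G, N ≤ MonoidHom.ker Φ.ρ ∧
                CosetCharacter.eigenvalues Φ q = t) ∧
              ∀ Φ : FDRep ℂ G, N ≤ MonoidHom.ker Φ.ρ →
                CosetCharacter.eigenvalues Φ q = t →
                Φ.character * ρ.1 = (Ψ ρ).character * ρ.1)) := by
  have := CosetCharacter.isCyclic_quotient hq
  refine ⟨hU.finite, fun ρ => Nat.card (CosetCharacter.twistStabilizer N ρ.1),
    fun ρ => CosetCharacter.card_twistStabilizer_eq_charInner (hU.1 ρ.2),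
    CosetCharacter.exists_isDecomposition hU hΘ,
    fun Ψ Ψ' hΨ hΨ' => hΨ.iff_rel hq hU hΨ', fun Ψ hΨ ρ => ⟨hΨ.character_pow hq hU ρ, ?_, ?_⟩⟩
  · exact fun Φ hΦ h => CosetCharacter.character_mul_eq_of_pow hq hΦ (hΨ.1 ρ) fun d =>
      (h d).trans (hΨ.character_pow hq hU ρ d).symm
  · intro M hM
    have hsol := CosetCharacter.solvesPowerSums_eigenvalues (q := q) (hΨ.1 ρ)
      (Nat.card (CosetCharacter.twistStabilizer N ρ.1)) hM
    have huniq := CosetCharacter.existsUnique_solvesPowerSums hsol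
    refine ⟨huniq, fun s hs => ?_⟩
    -- By uniqueness `s` consists of the `m`-th powers of the eigenvalues of `q` on `Ψ ρ`, so these
    -- eigenvalues are themselves one choice of roots.
    obtain rfl := huniq.unique hs hsol
    refine ⟨⟨_, rfl, rfl, CosetCharacter.character_eq_sum_eigenvalues _ _⟩, fun t ht =>
      ⟨CosetCharacter.exists_eigenvalues_eq_of_isChoiceOfRoots hq (hΨ.1 ρ) ht, ?_⟩⟩
    rintro Φ hΦ rfl
    exact CosetCharacter.character_mul_eq_of_pow hq hΦ (hΨ.1 ρ)
      (CosetCharacter.character_pow_mul_congr ht)
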